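/- For every $a\in\mathbb{R}$ define $g_a:\mathbb{R}\to\mathbb{R}$ by $g_a(x)=|x|^3\sin(2a\log|x|)$ for $x\neq0$ and $g_a(0)=0$. (a) For every $a\in\mathbb{R}$, $g_a$ is a $C^2$ function with $g_a(0)=g_a'(0)=0$ and $g_a''(x)=O(|x|)$ as $x\to0$. (b) There is a real number $a>0$ with the following property. Let $B$ be a standard Brownian motion on a filtered probability space $(\Omega,\mathcal{F},(\mathcal{F}_t)_{t\ge0},P)$, let $\sigma$ be a càdlàg $(\mathcal{F}_t)$-adapted process, put $X^c_t=\int_0^t\sigma_s\,dB_s$, let $T>0$, and suppose that $\sigma_s=1$ for all $s\in[0,T]$. Then, with $\Delta_n=\exp(-n\pi/a)$ (so that $\Delta_n\to0$) and $$\mathcal{V}^n_T(X^c,g_a)=\sum_{i=1}^{\lfloor T/\Delta_n\rfloor}g_a\bigl(X^c_{i\Delta_n}-X^c_{(i-1)\Delta_n}\bigr),$$ the random variables $\mathcal{V}^n_T(X^c,g_a)/\sqrt{\Delta_n}$ do not converge in law as $n\to\infty$. -/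

import Mathlib

open MeasureTheory ProbabilityTheory Filter Topology
open scoped NNReal

noncomputable section

namespace RealizedSkewness

/-- A path on `[0, ∞)` that is right-continuous and has left limits. -/
def IsCadlagPath (f : ℝ≥0 → ℝ) : Prop :=
  ∀ t : ℝ≥0, ContinuousWithinAt f (Set.Ici t) t ∧ ∃ l : ℝ, Tendsto f (𝓝[<] t) (𝓝 l)

/-- `B` is a standard Brownian motion relative to the filtration `𝓕`: it is a Brownian motion
(started at `0`, with almost surely continuous paths), it is adapted, and its increments after
time `s` are independent of `𝓕 s`. -/
structure IsBrownianMotionWrt {Ω : Type*} {mΩ : MeasurableSpace Ω} (𝓕 : Filtration ℝ≥0 mΩ)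
    (P : Measure Ω) (B : ℝ≥0 → Ω → ℝ) : Prop where
  isBrownianReal : IsBrownianReal B P
  stronglyAdapted : StronglyAdapted 𝓕 B
  indep_increment : ∀ s t : ℝ≥0, s ≤ t →
    Indep (MeasurableSpace.comap (fun ω ↦ B t ω - B s ω) inferInstance) (𝓕 s) P

/-- The `N`-th left-endpoint Riemann sum of `∫₀ᵗ σ dB` over the regular grid of `[0, t]`:
`∑_{i<N} σ_{it/N} (B_{(i+1)t/N} - B_{it/N})`. -/
def itoRiemannSum {Ω : Type*} (σ B : ℝ≥0 → Ω → ℝ) (t : ℝ≥0) (N : ℕ) (ω : Ω) : ℝ :=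
  ∑ i ∈ Finset.range N,
    σ ((i : ℝ≥0) * t / N) ω * (B (((i : ℝ≥0) + 1) * t / N) ω - B ((i : ℝ≥0) * t / N) ω)

/-- For a càdlàg adapted integrand `σ` and a Brownian motion `B`, the process `Y` is (a version of)
the Itô integral `Y_t = ∫₀ᵗ σ_s dB_s`: it has almost surely continuous paths, and for each `t` the
variable `Y_t` is the limit in probability of the left-endpoint Riemann sums.
This determines `Y` up to indistinguishability. -/
structure IsItoIntegral {Ω : Type*} {mΩ : MeasurableSpace Ω} (P : Measure Ω)
    (σ B Y : ℝ≥0 → Ω → ℝ) : Prop where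
  ae_continuous : ∀ᵐ ω ∂P, Continuous (fun t ↦ Y t ω)
  tendsto_riemannSum : ∀ t : ℝ≥0,
    TendstoInMeasure P (fun N ↦ itoRiemannSum σ B t N) atTop (Y t)

/-- The sum of `g` over the increments of `Y` along the grid of step `Δ` in `[0, T]`:
`∑_{i=1}^{⌊T/Δ⌋} g (Y_{iΔ} - Y_{(i-1)Δ})`. -/
def incrementSum {Ω : Type*} (Y : ℝ≥0 → Ω → ℝ) (g : ℝ → ℝ) (T Δ : ℝ≥0) (ω : Ω) : ℝ :=
  ∑ i ∈ Finset.Icc 1 ⌊T / Δ⌋₊, g (Y ((i : ℝ≥0) * Δ) ω - Y (((i - 1 : ℕ) : ℝ≥0) * Δ) ω)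

/-- A sequence of real random variables converges in law (to some probability law on `ℝ`). -/
def ConvergesInLaw {Ω : Type*} {mΩ : MeasurableSpace Ω} (P : Measure Ω) [IsProbabilityMeasure P]
    (V : ℕ → Ω → ℝ) : Prop :=
  ∃ (ν : Measure ℝ) (_ : IsProbabilityMeasure ν),
    TendstoInDistribution V atTop (id : ℝ → ℝ) (fun _ ↦ P) ν

/-- The function `g_a(x) = |x|³ sin(2a log|x|)` (equal to `0` at `x = 0`). -/
def g (a x : ℝ) : ℝ := |x| ^ 3 * Real.sin (2 * a * Real.log |x|)

/-- The step `Δₙ = exp(-nπ/a)`. -/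
def step (a : ℝ) (n : ℕ) : ℝ≥0 := ⟨Real.exp (-(n : ℝ) * Real.pi / a), (Real.exp_pos _).le⟩

end RealizedSkewness

end

namespace RealizedSkewness

/-! The function `g a` is nearly homogeneous of degree 3, but scaling shifts its phase. Scaling by
`√Δₙ` with `Δₙ = exp(-nπ/a)` shifts it by exactly `-nπ`, so `g a (√Δₙ x) = (-1)ⁿ Δₙ^(3/2) g a x`
(`g_sqrt_step_mul`). On `[0, T]` the increments of `Xc` are those of `B`. The normalized sum thus
has mean close to `(-1)ⁿ T m`, where `m` is the standard Gaussian mean of `g a`, and its variance is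
`O(Δₙ)`. If `m ≠ 0`, the even and odd subsequences converge in probability to `T m` and `-T m`,
which rules out a limit law. A suitable `a` exists because `m` vanishes at `a = 0` with derivative
`2 E[|Z|³ log|Z|] > 0` (`integral_cube_log_pos`, `exists_integral_g_ne_zero`). -/

/-! ### Regularity of `g a`. -/

/-- The bounded oscillating factor `s sin(2a log|x|) + c cos(2a log|x|)`. -/
noncomputable def oscillation (a s c x : ℝ) : ℝ :=
  s * Real.sin (2 * a * Real.log |x|) + c * Real.cos (2 * a * Real.log |x|)

lemma abs_oscillation_le (a s c x : ℝ) : |oscillation a s c x| ≤ |s| + |c| := by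
  unfold oscillation
  refine (abs_add_le _ _).trans (add_le_add ?_ ?_)
  · rw [abs_mul]
    exact mul_le_of_le_one_right (abs_nonneg _) (Real.abs_sin_le_one _)
  · rw [abs_mul]
    exact mul_le_of_le_one_right (abs_nonneg _) (Real.abs_cos_le_one _)

/-- The operator `x d/dx` preserves the span of the sine and the cosine, so successive derivatives
of `g a` only require tracking the pair `(s, c)`. -/
lemma hasDerivAt_oscillation (a s c : ℝ) {x : ℝ} (hx : x ≠ 0) :
    HasDerivAt (oscillation a s c) (oscillation a (-(2 * a * c)) (2 * a * s) x / x) x := by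
  have h : HasDerivAt (fun y : ℝ ↦ 2 * a * Real.log |y|) (2 * a * x⁻¹) x := by
    simp only [Real.log_abs]
    exact (Real.hasDerivAt_log hx).const_mul _
  refine ((h.sin.const_mul s).add (h.cos.const_mul c)).congr_deriv ?_
  unfold oscillation
  field_simp
  ring

lemma hasDerivAt_zero_of_abs_le_sq {f : ℝ → ℝ} {C : ℝ} (hf : ∀ x, |f x| ≤ C * x ^ 2) :
    HasDerivAt f 0 0 := by
  have h0 : f 0 = 0 := by simpa using hf 0
  rw [hasDerivAt_iff_isLittleO]
  have h1 : f =O[𝓝 0] fun x : ℝ ↦ x ^ 2 :=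
    Asymptotics.isBigO_of_le' (c := C) _ fun x ↦ by simpa using hf x
  have h2 : (fun x : ℝ ↦ x ^ 2) =o[𝓝 0] fun x : ℝ ↦ x := by
    simpa using Asymptotics.isLittleO_pow_pow (𝕜 := ℝ) (one_lt_two)
  simpa [h0] using h1.trans_isLittleO h2

lemma hasDerivAt_mul_oscillation (a s c : ℝ) (x : ℝ) :
    HasDerivAt (fun y ↦ y * |y| * oscillation a s c y)
      (|x| * oscillation a (2 * s - 2 * a * c) (2 * c + 2 * a * s) x) x := by
  rcases eq_or_ne x 0 with rfl | hx
  · simp only [abs_zero, zero_mul]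
    refine hasDerivAt_zero_of_abs_le_sq (C := |s| + |c|) fun x ↦ ?_
    rw [abs_mul, abs_mul, abs_abs, abs_mul_abs_self, ← sq, mul_comm]
    exact mul_le_mul_of_nonneg_right (abs_oscillation_le _ _ _ _) (sq_nonneg x)
  · have h1 : HasDerivAt (fun y : ℝ ↦ y * |y|) (2 * |x|) x := by
      refine ((hasDerivAt_id x).mul (hasDerivAt_abs hx)).congr_deriv ?_
      rw [id, self_mul_sign]
      ring
    refine (h1.mul (hasDerivAt_oscillation a s c hx)).congr_deriv ?_
    unfold oscillation
    field_simp
    ring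

lemma hasDerivAt_g (a x : ℝ) :
    HasDerivAt (g a) (x * |x| * oscillation a 3 (2 * a) x) x := by
  have hg : g a = fun y ↦ y * (y * |y| * oscillation a 1 0 y) := by
    ext y
    have h : |y| ^ 3 = y * (y * |y|) := by rw [pow_succ, sq_abs]; ring
    simp only [g, oscillation, h]
    ring
  rw [hg]
  refine ((hasDerivAt_id' x).mul (hasDerivAt_mul_oscillation a 1 0 x)).congr_deriv ?_
  unfold oscillation
  ring

lemma deriv_g (a : ℝ) : deriv (g a) = fun x ↦ x * |x| * oscillation a 3 (2 * a) x :=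
  funext fun x ↦ (hasDerivAt_g a x).deriv

lemma deriv_deriv_g (a : ℝ) :
    deriv (deriv (g a)) = fun x ↦ |x| * oscillation a (6 - 4 * a ^ 2) (10 * a) x := by
  rw [deriv_g]
  funext x
  rw [(hasDerivAt_mul_oscillation a 3 (2 * a) x).deriv]
  congr 2 <;> ring

lemma continuous_abs_mul_oscillation (a s c : ℝ) :
    Continuous fun x ↦ |x| * oscillation a s c x := by
  refine continuous_iff_continuousAt.2 fun x ↦ ?_
  rcases eq_or_ne x 0 with rfl | hx
  · have h : Tendsto (fun x : ℝ ↦ (|s| + |c|) * |x|) (𝓝 0) (𝓝 0) := by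
      have : Continuous fun x : ℝ ↦ (|s| + |c|) * |x| := by fun_prop
      simpa using this.tendsto 0
    rw [ContinuousAt, abs_zero, zero_mul]
    refine squeeze_zero_norm (fun x ↦ ?_) h
    rw [Real.norm_eq_abs, abs_mul, abs_abs, mul_comm]
    exact mul_le_mul_of_nonneg_right (abs_oscillation_le _ _ _ _) (abs_nonneg x)
  · exact continuous_abs.continuousAt.mul (hasDerivAt_oscillation a s c hx).continuousAt

lemma contDiff_g (a : ℝ) : ContDiff ℝ 2 (g a) := by
  rw [show (2 : WithTop ℕ∞) = 1 + 1 by norm_num, contDiff_succ_iff_deriv]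
  refine ⟨fun x ↦ (hasDerivAt_g a x).differentiableAt, by simp, ?_⟩
  rw [contDiff_one_iff_deriv]
  refine ⟨fun x ↦ ?_, ?_⟩
  · rw [deriv_g]
    exact (hasDerivAt_mul_oscillation a 3 (2 * a) x).differentiableAt
  · rw [deriv_deriv_g]
    exact continuous_abs_mul_oscillation _ _ _

lemma deriv_deriv_g_isBigO (a : ℝ) :
    deriv (deriv (g a)) =O[𝓝 0] (fun x : ℝ ↦ |x|) := by
  rw [deriv_deriv_g]
  refine Asymptotics.isBigO_of_le' (c := |6 - 4 * a ^ 2| + |10 * a|) _ fun x ↦ ?_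
  rw [Real.norm_eq_abs, Real.norm_eq_abs, abs_mul, mul_comm]
  exact mul_le_mul_of_nonneg_right (abs_oscillation_le _ _ _ _) (abs_nonneg _)

/-! ### Gaussian integrals and a nonzero mean. -/

lemma abs_g_le (a x : ℝ) : |g a x| ≤ |x| ^ 3 := by
  rw [g, abs_mul, abs_pow, abs_abs]
  exact mul_le_of_le_one_right (by positivity) (Real.abs_sin_le_one _)

@[fun_prop]
lemma measurable_g (a : ℝ) : Measurable (g a) := (contDiff_g a).continuous.measurable

lemma integrable_pow_gaussianReal (v : ℝ≥0) (k : ℕ) :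
    Integrable (fun x : ℝ ↦ x ^ k) (gaussianReal 0 v) := by
  have h := (memLp_id_gaussianReal (μ := 0) (v := v) (k : ℝ≥0)).integrable_norm_pow'
  refine (integrable_norm_iff (by fun_prop)).1 ?_
  simpa using h

lemma memLp_two_g (a : ℝ) (v : ℝ≥0) : MemLp (g a) 2 (gaussianReal 0 v) := by
  rw [memLp_two_iff_integrable_sq (measurable_g a).aestronglyMeasurable]
  refine (integrable_pow_gaussianReal v 6).mono' (by fun_prop) (ae_of_all _ fun x ↦ ?_)
  rw [norm_pow, Real.norm_eq_abs]
  calc |g a x| ^ 2 ≤ (|x| ^ 3) ^ 2 := by gcongr; exact abs_g_le a x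
    _ = x ^ 6 := by rw [← pow_mul, pow_mul' |x| 3 2, sq_abs, ← pow_mul]

/-- Serves as the integrable bound for differentiating the mean of `g a` in `a`; it follows from
`|log y| ≤ y + 1/y`. -/
lemma abs_cube_mul_abs_log_le (x : ℝ) : |x| ^ 3 * |Real.log (|x|)| ≤ x ^ 2 + x ^ 4 := by
  rcases eq_or_ne x 0 with rfl | hx
  · simp
  have hx' : 0 < |x| := abs_pos.2 hx
  have h1 := Real.log_le_sub_one_of_pos hx'
  have h2 := Real.one_sub_inv_le_log_of_pos hx'
  have h3 : |Real.log (|x|)| ≤ |x| + |x|⁻¹ := by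
    have := inv_pos.2 hx'
    rw [abs_le]; constructor <;> linarith
  calc |x| ^ 3 * |Real.log (|x|)| ≤ |x| ^ 3 * (|x| + |x|⁻¹) := by gcongr
    _ = |x| ^ 2 + |x| ^ 4 := by field_simp; ring
    _ = x ^ 2 + x ^ 4 := by rw [sq_abs, pow_mul |x| 2 2, sq_abs, ← pow_mul]

lemma integrable_cube_log :
    Integrable (fun x : ℝ ↦ |x| ^ 3 * Real.log |x|) (gaussianReal 0 1) := by
  refine ((integrable_pow_gaussianReal 1 2).add (integrable_pow_gaussianReal 1 4)).mono'
    (by fun_prop) (ae_of_all _ fun x ↦ ?_)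
  rw [Real.norm_eq_abs, abs_mul, abs_pow, abs_abs]
  exact abs_cube_mul_abs_log_le x

/-- The minorant is chosen to have mean zero under the standard Gaussian. With `y = |x|`, use `log y
≥ 1 - 1/y` and `y³ - y² - (y² - 1)/2 = (y - 1)² (y + 1/2)`. -/
lemma sq_sub_one_half_lt {x : ℝ} (h0 : x ≠ 0) (h1 : |x| ≠ 1) :
    (x ^ 2 - 1) / 2 < |x| ^ 3 * Real.log |x| := by
  have hx : 0 < |x| := abs_pos.2 h0
  have hl : 1 - |x|⁻¹ ≤ Real.log |x| := Real.one_sub_inv_le_log_of_pos hx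
  have h2 : |x| ^ 3 * (1 - |x|⁻¹) ≤ |x| ^ 3 * Real.log |x| := by gcongr
  have h3 : |x| ^ 3 * (1 - |x|⁻¹) = |x| ^ 3 - |x| ^ 2 := by field_simp
  have h4 : 0 < (|x| - 1) ^ 2 * (|x| + 1 / 2) := by
    have := sub_ne_zero.2 h1
    positivity
  rw [← sq_abs x]
  nlinarith

lemma integral_sq_gaussianReal (v : ℝ≥0) : ∫ x, x ^ 2 ∂(gaussianReal 0 v) = v := by
  have h := variance_fun_id_gaussianReal (μ := 0) (v := v)
  rw [variance_eq_integral (by fun_prop)] at h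
  simpa using h

lemma integral_cube_log_pos : 0 < ∫ x, |x| ^ 3 * Real.log |x| ∂(gaussianReal 0 1) := by
  have hs : Integrable (fun x : ℝ ↦ (x ^ 2 - 1) / 2) (gaussianReal 0 1) :=
    ((integrable_pow_gaussianReal 1 2).sub (integrable_const 1)).div_const 2
  have h0 : ∫ x, (x ^ 2 - 1) / 2 ∂(gaussianReal 0 1) = 0 := by
    rw [integral_div, integral_sub (integrable_pow_gaussianReal 1 2) (integrable_const 1),
      integral_sq_gaussianReal]
    simp
  have hae : ∀ᵐ x ∂(gaussianReal 0 1), x ≠ 0 ∧ |x| ≠ 1 := by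
    refine (gaussianReal_absolutelyContinuous 0 one_ne_zero).ae_le ?_
    have hfin : ({0, 1, -1} : Set ℝ).Finite := Set.toFinite _
    filter_upwards [hfin.countable.ae_notMem volume] with x hx
    simp only [Set.mem_insert_iff, Set.mem_singleton_iff, not_or] at hx
    exact ⟨hx.1, fun h ↦ (eq_or_eq_neg_of_abs_eq h).elim hx.2.1 hx.2.2⟩
  have hpos : 0 < ∫ x, (|x| ^ 3 * Real.log |x| - (x ^ 2 - 1) / 2) ∂(gaussianReal 0 1) := by
    have hlt : ∀ᵐ x ∂(gaussianReal 0 1), 0 < |x| ^ 3 * Real.log |x| - (x ^ 2 - 1) / 2 := by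
      filter_upwards [hae] with x hx using sub_pos.2 (sq_sub_one_half_lt hx.1 hx.2)
    refine (integral_nonneg_of_ae (hlt.mono fun x hx ↦ hx.le)).lt_of_ne' fun h ↦ ?_
    rw [integral_eq_zero_iff_of_nonneg_ae (hlt.mono fun x hx ↦ hx.le)
      (integrable_cube_log.sub hs)] at h
    obtain ⟨x, hx, hx'⟩ := (hlt.and h).exists
    exact hx.ne' hx'
  rw [integral_sub integrable_cube_log hs, h0] at hpos
  simpa using hpos

lemma exists_integral_g_ne_zero : ∃ a : ℝ, 0 < a ∧ ∫ x, g a x ∂(gaussianReal 0 1) ≠ 0 := by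
  by_contra! h
  let u : ℕ → ℝ := fun n ↦ 1 / ((n : ℝ) + 1)
  have hu : ∀ n, 0 < u n := fun n ↦ by positivity
  have hlim : Tendsto (fun n ↦ ∫ x, g (u n) x / u n ∂(gaussianReal 0 1)) atTop
      (𝓝 (∫ x, 2 * (|x| ^ 3 * Real.log |x|) ∂(gaussianReal 0 1))) := by
    refine tendsto_integral_of_dominated_convergence (fun x ↦ 2 * (x ^ 2 + x ^ 4))
      (fun n ↦ ((measurable_g _).div_const _).aestronglyMeasurable)
      (((integrable_pow_gaussianReal 1 2).add (integrable_pow_gaussianReal 1 4)).const_mul 2)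
      (fun n ↦ ae_of_all _ fun x ↦ ?_) (ae_of_all _ fun x ↦ ?_)
    · rw [Real.norm_eq_abs, abs_div, abs_of_pos (hu n), div_le_iff₀ (hu n), g, abs_mul,
        abs_pow, abs_abs]
      calc |x| ^ 3 * |Real.sin (2 * u n * Real.log |x|)|
          ≤ |x| ^ 3 * |2 * u n * Real.log (|x|)| :=
            mul_le_mul_of_nonneg_left Real.abs_sin_le_abs (by positivity)
        _ = 2 * (|x| ^ 3 * |Real.log (|x|)|) * u n := by
            rw [abs_mul, abs_mul, abs_of_pos (hu n), abs_two]; ring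
        _ ≤ _ := by
            have := hu n
            gcongr
            exact abs_cube_mul_abs_log_le x
    -- Since `g 0 x = 0`, the quotient `g (u n) x / u n` is the slope at `0` of `a ↦ g a x`.
    · have hd : HasDerivAt (fun a : ℝ ↦ g a x) (2 * (|x| ^ 3 * Real.log |x|)) 0 := by
        have h1 : HasDerivAt (fun a : ℝ ↦ 2 * a * Real.log |x|) (2 * Real.log |x|) 0 := by
          simpa using ((hasDerivAt_id (0 : ℝ)).const_mul 2).mul_const (Real.log |x|)
        refine (h1.sin.const_mul (|x| ^ 3)).congr_deriv ?_
        simp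
        ring
      have hu0 : Tendsto u atTop (𝓝[≠] 0) :=
        tendsto_nhdsWithin_iff.2 ⟨tendsto_one_div_add_atTop_nhds_zero_nat,
          Eventually.of_forall fun n ↦ (hu n).ne'⟩
      refine ((hasDerivAt_iff_tendsto_slope.1 hd).comp hu0).congr fun n ↦ ?_
      simp [slope_def_field, g]
  have h0 : (fun n ↦ ∫ x, g (u n) x / u n ∂(gaussianReal 0 1)) = fun _ ↦ 0 := by
    funext n
    rw [integral_div, h _ (hu n), zero_div]
  rw [h0, integral_const_mul] at hlim
  have := tendsto_nhds_unique hlim tendsto_const_nhds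
  linarith [integral_cube_log_pos]

/-! ### Scaling along the steps `Δₙ`. -/

lemma g_sqrt_step_mul {a : ℝ} (ha : 0 < a) (n : ℕ) (x : ℝ) :
    g a (√(step a n) * x) = (-1) ^ n * (step a n * √(step a n)) * g a x := by
  rcases eq_or_ne x 0 with rfl | hx
  · simp [g]
  have hs : (0 : ℝ) < step a n := Real.exp_pos _
  have hs' : 0 < √(step a n : ℝ) := Real.sqrt_pos.2 hs
  have hlog : Real.log √(step a n : ℝ) = -(n : ℝ) * Real.pi / a / 2 := by
    rw [Real.log_sqrt hs.le]
    exact congrArg (· / 2) (Real.log_exp _)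
  have harg : 2 * a * Real.log |√(step a n) * x| = 2 * a * Real.log |x| - n * Real.pi := by
    rw [abs_mul, Real.log_mul (abs_ne_zero.2 hs'.ne') (abs_ne_zero.2 hx), abs_of_pos hs', hlog]
    field_simp
    ring
  have hcube : √(step a n : ℝ) ^ 3 = step a n * √(step a n : ℝ) := by
    rw [pow_succ, Real.sq_sqrt hs.le]
  rw [g, harg, Real.sin_sub_nat_mul_pi, abs_mul, mul_pow, abs_of_pos hs', hcube, g]
  ring

lemma gaussianReal_map_sqrt_mul (v : ℝ≥0) :
    (gaussianReal 0 1).map (fun x ↦ √(v : ℝ) * x) = gaussianReal 0 v := by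
  rw [gaussianReal_map_const_mul, mul_zero, mul_one]
  congr 1
  ext
  simp

lemma integral_g_gaussianReal_step {a : ℝ} (ha : 0 < a) (n : ℕ) :
    ∫ x, g a x ∂(gaussianReal 0 (step a n)) =
      (-1) ^ n * (step a n * √(step a n)) * ∫ x, g a x ∂(gaussianReal 0 1) := by
  rw [← gaussianReal_map_sqrt_mul, integral_map (by fun_prop) (by fun_prop), ← integral_const_mul]
  simp_rw [g_sqrt_step_mul ha]

lemma integral_g_sq_gaussianReal_step {a : ℝ} (ha : 0 < a) (n : ℕ) :
    ∫ x, g a x ^ 2 ∂(gaussianReal 0 (step a n)) =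
      (step a n : ℝ) ^ 3 * ∫ x, g a x ^ 2 ∂(gaussianReal 0 1) := by
  rw [← gaussianReal_map_sqrt_mul, integral_map (by fun_prop) (by fun_prop), ← integral_const_mul]
  refine integral_congr_ae (ae_of_all _ fun x ↦ ?_)
  simp only
  rw [g_sqrt_step_mul ha, mul_pow, mul_pow, mul_pow, ← pow_mul, mul_comm n, pow_mul,
    Real.sq_sqrt (NNReal.coe_nonneg _), neg_one_sq, one_pow]
  ring

lemma incrementSum_eq_sum_range {Ω : Type*} (Y : ℝ≥0 → Ω → ℝ) (f : ℝ → ℝ) (T Δ : ℝ≥0) (ω : Ω) :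
    incrementSum Y f T Δ ω = ∑ i ∈ Finset.range ⌊T / Δ⌋₊,
      f (Y (((i + 1 : ℕ) : ℝ≥0) * Δ) ω - Y ((i : ℝ≥0) * Δ) ω) := by
  rw [incrementSum, Finset.range_eq_Ico, ← Finset.Ico_add_one_right_eq_Icc,
    Finset.sum_Ico_eq_sum_range, Finset.sum_Ico_eq_sum_range]
  simp [add_comm]

lemma tendsto_step {a : ℝ} (ha : 0 < a) : Tendsto (step a) atTop (𝓝 0) := by
  rw [← NNReal.tendsto_coe]
  refine Real.tendsto_exp_atBot.comp ?_
  have h : Tendsto (fun n : ℕ ↦ (n : ℝ) * (Real.pi / a)) atTop atTop :=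
    tendsto_natCast_atTop_atTop.atTop_mul_const (by positivity)
  refine (tendsto_neg_atTop_atBot.comp h).congr fun n ↦ ?_
  simp only [Function.comp_apply]
  ring

lemma step_pos (a : ℝ) (n : ℕ) : 0 < step a n := Real.exp_pos _

lemma floor_div_mul_le (T : ℝ≥0) {δ : ℝ≥0} (hδ : 0 < δ) : (⌊T / δ⌋₊ : ℝ≥0) * δ ≤ T :=
  (le_div_iff₀ hδ).1 (Nat.floor_le zero_le)

lemma tendsto_floor_div_mul (T : ℝ≥0) {u : ℕ → ℝ≥0} (hpos : ∀ n, 0 < u n)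
    (hu : Tendsto u atTop (𝓝 0)) :
    Tendsto (fun n ↦ (⌊T / u n⌋₊ : ℝ) * u n) atTop (𝓝 T) := by
  have hu' : Tendsto (fun n ↦ (T : ℝ) - u n) atTop (𝓝 T) := by
    simpa using tendsto_const_nhds.sub (NNReal.tendsto_coe.2 hu)
  refine tendsto_of_tendsto_of_tendsto_of_le_of_le hu' tendsto_const_nhds (fun n ↦ ?_) fun n ↦ ?_
  · have h := (div_lt_iff₀ (hpos n)).1 (Nat.lt_floor_add_one (T / u n))
    have h' : (T : ℝ) < (⌊T / u n⌋₊ + 1) * u n := by exact_mod_cast h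
    simp only
    linarith
  · exact_mod_cast floor_div_mul_le T (hpos n)

/-! ### Increment sums of Brownian motion and of the Itô integral. -/

section Brownian

variable {Ω : Type*} {mΩ : MeasurableSpace Ω} {P : Measure Ω} {B : ℝ≥0 → Ω → ℝ}

lemma hasLaw_increment (hB : IsPreBrownianReal B P) (δ : ℝ≥0) (i : ℕ) :
    HasLaw (fun ω ↦ B (((i + 1 : ℕ) : ℝ≥0) * δ) ω - B ((i : ℝ≥0) * δ) ω) (gaussianReal 0 δ) P := by
  have h := hB.hasLaw_sub (((i + 1 : ℕ) : ℝ≥0) * δ) ((i : ℝ≥0) * δ)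
  have hd : nndist (((i + 1 : ℕ) : ℝ≥0) * δ).1 ((i : ℝ≥0) * δ).1 = δ := by
    ext
    rw [coe_nndist, Real.dist_eq]
    simp only [NNReal.val_eq_coe]
    push_cast
    rw [show ((i : ℝ) + 1) * δ - i * δ = δ by ring, NNReal.abs_eq]
  rwa [hd] at h

lemma memLp_g_increment (hB : IsPreBrownianReal B P) (a : ℝ) (δ : ℝ≥0) (i : ℕ) :
    MemLp (fun ω ↦ g a (B (((i + 1 : ℕ) : ℝ≥0) * δ) ω - B ((i : ℝ≥0) * δ) ω)) 2 P := by
  have h := hasLaw_increment hB δ i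
  have hg := memLp_two_g a δ
  rw [← h.map_eq] at hg
  exact (memLp_map_measure_iff (by fun_prop) h.aemeasurable).1 hg

lemma memLp_incrementSum (hB : IsPreBrownianReal B P) (a : ℝ) (T δ : ℝ≥0) :
    MemLp (incrementSum B (g a) T δ) 2 P := by
  simp_rw [funext (incrementSum_eq_sum_range B (g a) T δ)]
  exact memLp_finsetSum _ fun i _ ↦ memLp_g_increment hB a δ i

lemma integral_incrementSum [IsProbabilityMeasure P] (hB : IsPreBrownianReal B P) (a : ℝ)
    (T δ : ℝ≥0) :
    P[incrementSum B (g a) T δ] = ⌊T / δ⌋₊ * ∫ x, g a x ∂(gaussianReal 0 δ) := by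
  simp_rw [funext (incrementSum_eq_sum_range B (g a) T δ)]
  rw [integral_finsetSum _ fun i _ ↦ (memLp_g_increment hB a δ i).integrable one_le_two]
  have h (i : ℕ) := (hasLaw_increment hB δ i).integral_comp (f := g a) (by fun_prop)
  simp only [Function.comp_def] at h
  simp only [h]
  simp

lemma variance_incrementSum_le [IsProbabilityMeasure P] (hB : IsPreBrownianReal B P) (a : ℝ)
    (T δ : ℝ≥0) :
    Var[incrementSum B (g a) T δ; P] ≤ ⌊T / δ⌋₊ * ∫ x, g a x ^ 2 ∂(gaussianReal 0 δ) := by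
  have hmono : Monotone fun i : ℕ ↦ (i : ℝ≥0) * δ := fun i j hij ↦ by
    simp only
    gcongr
  have hind := (hB.hasIndepIncrements.nat hmono).comp (fun _ ↦ g a) fun _ ↦ measurable_g a
  have hsum : incrementSum B (g a) T δ = ∑ i ∈ Finset.range ⌊T / δ⌋₊,
      fun ω ↦ g a (B (((i + 1 : ℕ) : ℝ≥0) * δ) ω - B ((i : ℝ≥0) * δ) ω) := by
    ext ω
    rw [incrementSum_eq_sum_range, Finset.sum_apply]
  rw [hsum, IndepFun.variance_sum (fun i _ ↦ memLp_g_increment hB a δ i)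
    fun i _ j _ hij ↦ hind.indepFun hij]
  refine (Finset.sum_le_card_nsmul _ _ (∫ x, g a x ^ 2 ∂(gaussianReal 0 δ)) fun i _ ↦ ?_).trans_eq
    (by simp)
  refine (variance_le_expectation_sq (memLp_g_increment hB a δ i).aestronglyMeasurable).trans_eq ?_
  exact (hasLaw_increment hB δ i).integral_comp (f := fun x ↦ g a x ^ 2) (by fun_prop)

lemma tendstoInMeasure_of_tendsto_variance [IsProbabilityMeasure P] {W : ℕ → Ω → ℝ} {c : ℝ}
    (hW : ∀ n, MemLp (W n) 2 P) (hmean : Tendsto (fun n ↦ P[W n]) atTop (𝓝 c))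
    (hvar : Tendsto (fun n ↦ Var[W n; P]) atTop (𝓝 0)) :
    TendstoInMeasure P W atTop fun _ ↦ c := by
  rw [tendstoInMeasure_iff_norm]
  intro ε hε
  have hlim : Tendsto (fun n ↦ ENNReal.ofReal (Var[W n; P] / (ε / 2) ^ 2)) atTop (𝓝 0) := by
    simpa using ENNReal.tendsto_ofReal (hvar.div_const ((ε / 2) ^ 2))
  refine tendsto_of_tendsto_of_tendsto_of_le_of_le' tendsto_const_nhds hlim
    (Eventually.of_forall fun _ ↦ zero_le) ?_
  filter_upwards [Metric.tendsto_nhds.1 hmean (ε / 2) (half_pos hε)] with n hn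
  refine (measure_mono fun ω hω ↦ ?_).trans (meas_ge_le_variance_div_sq (hW n) (half_pos hε))
  simp only [Set.mem_ofPred_eq, Real.norm_eq_abs] at hω ⊢
  rw [Real.dist_eq] at hn
  have := abs_sub_le (W n ω) (P[W n]) c
  linarith

lemma tendstoInMeasure_incrementSum [IsProbabilityMeasure P] (hB : IsPreBrownianReal B P) {a : ℝ}
    (ha : 0 < a) (T : ℝ≥0) :
    TendstoInMeasure P
      (fun n ω ↦ (-1) ^ n / √(step a n : ℝ) * incrementSum B (g a) T (step a n) ω) atTop
      fun _ ↦ T * ∫ x, g a x ∂(gaussianReal 0 1) := by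
  have hδ := tendsto_floor_div_mul T (step_pos a) (tendsto_step ha)
  have hpos (n : ℕ) : (0 : ℝ) < step a n := step_pos a n
  refine tendstoInMeasure_of_tendsto_variance
    (fun n ↦ (memLp_incrementSum hB a T _).const_mul _) ?_ ?_
  · refine (hδ.mul_const _).congr fun n ↦ ?_
    have hs : √(step a n : ℝ) ≠ 0 := (Real.sqrt_pos.2 (hpos n)).ne'
    have h1 : ((-1 : ℝ) ^ n) * (-1) ^ n = 1 := by rw [← mul_pow]; simp
    rw [integral_const_mul, integral_incrementSum hB, integral_g_gaussianReal_step ha]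
    field_simp
    rw [sq, h1, mul_one]
  -- The `⌊T/Δₙ⌋` terms have second moment `Δₙ³ M` each; dividing by `Δₙ` leaves `(⌊T/Δₙ⌋ Δₙ) Δₙ M`,
  -- of order `Δₙ`.
  · set M := ∫ x, g a x ^ 2 ∂(gaussianReal 0 1) with hM
    have hlim : Tendsto (fun n ↦ (⌊T / step a n⌋₊ : ℝ) * step a n * (step a n * M)) atTop (𝓝 0) := by
      simpa using hδ.mul ((NNReal.tendsto_coe.2 (tendsto_step ha)).mul_const M)
    refine squeeze_zero (fun n ↦ variance_nonneg _ _) (fun n ↦ ?_) hlim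
    rw [variance_const_mul, div_pow, Real.sq_sqrt (hpos n).le, ← pow_mul, mul_comm n, pow_mul,
      neg_one_sq, one_pow]
    refine (mul_le_mul_of_nonneg_left (variance_incrementSum_le hB a T _)
      (one_div_pos.2 (hpos n)).le).trans_eq ?_
    rw [integral_g_sq_gaussianReal_step ha, ← hM]
    have := (hpos n).ne'
    field_simp

/-- With `σ = 1` the Riemann sums telescope. The term `B 0` can stay, as it cancels in increments.
-/
lemma itoIntegral_ae_eq {σ X : ℝ≥0 → Ω → ℝ} {T t : ℝ≥0}
    (hX : IsItoIntegral P σ B X) (hσ : ∀ᵐ ω ∂P, ∀ s ≤ T, σ s ω = 1) (ht : t ≤ T) :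
    X t =ᵐ[P] fun ω ↦ B t ω - B 0 ω := by
  refine tendstoInMeasure_ae_unique (hX.tendsto_riemannSum t) ?_
  have hc : TendstoInMeasure P (fun (_ : ℕ) ω ↦ B t ω - B 0 ω) atTop fun ω ↦ B t ω - B 0 ω := by
    intro ε hε
    simp [hε.not_ge]
  refine hc.congr' ?_ EventuallyEq.rfl
  -- For `N = 0` the Riemann sum is empty and need not equal the increment.
  filter_upwards [eventually_gt_atTop 0] with N hN
  filter_upwards [hσ] with ω hω
  have hN' : (N : ℝ≥0) ≠ 0 := by exact_mod_cast hN.ne'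
  have h : itoRiemannSum σ B t N ω = ∑ i ∈ Finset.range N,
      (B (((i + 1 : ℕ) : ℝ≥0) * t / N) ω - B ((i : ℝ≥0) * t / N) ω) := by
    refine Finset.sum_congr rfl fun i hi ↦ ?_
    have hi' : (i : ℝ≥0) ≤ N := by exact_mod_cast (Finset.mem_range.1 hi).le
    have hle : (i : ℝ≥0) * t / N ≤ T := by
      refine (div_le_of_le_mul₀ zero_le zero_le ?_).trans ht
      rw [mul_comm]
      gcongr
    rw [hω _ hle, one_mul, Nat.cast_succ]
  rw [h, Finset.sum_range_sub fun i : ℕ ↦ B ((i : ℝ≥0) * t / N) ω]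
  simp [mul_div_cancel_left₀ t hN']

lemma incrementSum_ae_eq {σ X : ℝ≥0 → Ω → ℝ} {T : ℝ≥0} (hX : IsItoIntegral P σ B X)
    (hσ : ∀ᵐ ω ∂P, ∀ s ≤ T, σ s ω = 1) (f : ℝ → ℝ) {δ : ℝ≥0} (hδ : 0 < δ) :
    incrementSum X f T δ =ᵐ[P] incrementSum B f T δ := by
  have hae : ∀ᵐ ω ∂P, ∀ i : ℕ, (i : ℝ≥0) * δ ≤ T →
      X ((i : ℝ≥0) * δ) ω = B ((i : ℝ≥0) * δ) ω - B 0 ω := by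
    rw [ae_all_iff]
    intro i
    by_cases h : (i : ℝ≥0) * δ ≤ T
    · filter_upwards [itoIntegral_ae_eq hX hσ h] with ω hω _ using hω
    · exact ae_of_all _ fun ω h' ↦ absurd h' h
  filter_upwards [hae] with ω hω
  have hle {i : ℕ} (hi : i ≤ ⌊T / δ⌋₊) : (i : ℝ≥0) * δ ≤ T :=
    le_trans (by gcongr) (floor_div_mul_le T hδ)
  rw [incrementSum_eq_sum_range, incrementSum_eq_sum_range]
  refine Finset.sum_congr rfl fun i hi ↦ ?_
  have hi' := Finset.mem_range.1 hi
  rw [hω _ (hle hi'), hω _ (hle hi'.le), sub_sub_sub_cancel_right]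

end Brownian

/-! ### Failure of convergence in law. -/

lemma eq_dirac_of_tendstoInDistribution {Ω : Type*} {mΩ : MeasurableSpace Ω} {P : Measure Ω}
    [IsProbabilityMeasure P] {V : ℕ → Ω → ℝ} {ν : Measure ℝ} [IsProbabilityMeasure ν] {c : ℝ}
    (hV : TendstoInDistribution V atTop (id : ℝ → ℝ) (fun _ ↦ P) ν) {u : ℕ → ℕ}
    (hu : Tendsto u atTop atTop) (hc : TendstoInMeasure P (V ∘ u) atTop fun _ ↦ c) :
    ν = Measure.dirac c := by
  have h1 : TendstoInDistribution (V ∘ u) atTop (id : ℝ → ℝ) (fun _ ↦ P) ν :=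
    ⟨fun i ↦ hV.forall_aemeasurable (u i), hV.aemeasurable_limit, hV.tendsto.comp hu⟩
  have h2 := hc.tendstoInDistribution fun i ↦ hV.forall_aemeasurable (u i)
  have h := tendstoInDistribution_unique _ h1 h2
  simpa using h

/-- A sequence whose alternating sign modification converges in probability to a nonzero constant
does not converge in law. -/
lemma not_convergesInLaw_of_alternating {Ω : Type*} {mΩ : MeasurableSpace Ω} {P : Measure Ω}
    [IsProbabilityMeasure P] {V : ℕ → Ω → ℝ} {c : ℝ} (hc : c ≠ 0)
    (hV : TendstoInMeasure P (fun n ω ↦ (-1) ^ n * V n ω) atTop fun _ ↦ c) :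
    ¬ ConvergesInLaw P V := by
  rintro ⟨ν, _, hν⟩
  have hu0 : Tendsto (fun n : ℕ ↦ 2 * n) atTop atTop :=
    tendsto_atTop_mono (fun n ↦ by simp only [id]; omega) tendsto_id
  have hu1 : Tendsto (fun n : ℕ ↦ 2 * n + 1) atTop atTop := 
    tendsto_atTop_mono (fun n ↦ by simp only [id]; omega) tendsto_id
  have h0 : TendstoInMeasure P (V ∘ fun n ↦ 2 * n) atTop fun _ ↦ c := by
    refine (hV.comp hu0).congr_left fun n ↦ ae_of_all _ fun ω ↦ ?_
    simp
  have h1 : TendstoInMeasure P (V ∘ fun n ↦ 2 * n + 1) atTop fun _ ↦ -c := by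
    rw [tendstoInMeasure_iff_norm] at hV ⊢
    intro ε hε
    refine ((hV ε hε).comp hu1).congr fun n ↦ ?_
    simp only [Function.comp_apply, pow_succ, pow_mul]
    congr! 4 with ω
    rw [← norm_neg]
    congr 1
    ring
  -- A limit law would be the Dirac mass at both `c` and `-c`, forcing `c = 0`.
  have h := (eq_dirac_of_tendstoInDistribution hν hu0 h0).symm.trans
    (eq_dirac_of_tendstoInDistribution hν hu1 h1)
  exact hc (self_eq_neg.1 (dirac_eq_dirac_iff.1 h))

end RealizedSkewness

theorem proposition1 :
    (∀ a : ℝ,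
      ContDiff ℝ 2 (RealizedSkewness.g a) ∧
      RealizedSkewness.g a 0 = 0 ∧
      deriv (RealizedSkewness.g a) 0 = 0 ∧
      deriv (deriv (RealizedSkewness.g a)) =O[𝓝 0] (fun x : ℝ ↦ |x|)) ∧
    (∃ a : ℝ, 0 < a ∧
      ∀ (Ω : Type*) (mΩ : MeasurableSpace Ω) (P : Measure Ω) [IsProbabilityMeasure P]
        (𝓕 : Filtration ℝ≥0 mΩ) (B σ Xc : ℝ≥0 → Ω → ℝ) (T : ℝ≥0),
        0 < T →
        RealizedSkewness.IsBrownianMotionWrt 𝓕 P B →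
        StronglyAdapted 𝓕 σ →
        (∀ ω, RealizedSkewness.IsCadlagPath (fun t ↦ σ t ω)) →
        RealizedSkewness.IsItoIntegral P σ B Xc →
        (∀ᵐ ω ∂P, ∀ s ≤ T, σ s ω = 1) →
        (∀ n : ℕ, AEMeasurable
          (RealizedSkewness.incrementSum Xc (RealizedSkewness.g a) T
            (RealizedSkewness.step a n)) P) ∧
        ¬ RealizedSkewness.ConvergesInLaw P (fun n ω ↦
          RealizedSkewness.incrementSum Xc (RealizedSkewness.g a) T
            (RealizedSkewness.step a n) ω / Real.sqrt (RealizedSkewness.step a n : ℝ))) := by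
  refine ⟨fun a ↦ ⟨RealizedSkewness.contDiff_g a, by simp [RealizedSkewness.g],
    by simp [RealizedSkewness.deriv_g], RealizedSkewness.deriv_deriv_g_isBigO a⟩, ?_⟩
  obtain ⟨a, ha, hm⟩ := RealizedSkewness.exists_integral_g_ne_zero
  refine ⟨a, ha, fun Ω mΩ P _ 𝓕 B σ Xc T hT hB _ _ hX hσ ↦ ?_⟩
  have hpre := hB.isBrownianReal.toIsPreBrownianReal
  have hae (n : ℕ) := RealizedSkewness.incrementSum_ae_eq hX hσ (RealizedSkewness.g a)
    (RealizedSkewness.step_pos a n)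
  refine ⟨fun n ↦ (RealizedSkewness.memLp_incrementSum hpre a T _).aemeasurable.congr (hae n).symm,
    RealizedSkewness.not_convergesInLaw_of_alternating
      (mul_ne_zero (NNReal.coe_ne_zero.2 hT.ne') hm) ?_⟩
  refine (RealizedSkewness.tendstoInMeasure_incrementSum hpre ha T).congr_left fun n ↦ ?_
  filter_upwards [hae n] with ω hω
  rw [hω]
  ring
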